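/- Let $H$ be a real separable Hilbert space (of finite or infinite dimension), and let $\nu$ be a $\sigma$-finite Borel measure on $H$ with $\nu(\{0\})=0$ and $\int_H(\|z\|^2\wedge 1)\,\nu(dz)<\infty$. On a probability space $(\Omega,\mathcal F,\mathbb P)$ let $N$ be a Poisson random measure on $H\times[0,\infty)$ with intensity measure $\nu(dz)\,dt$, let $\tilde N(dz,dt)=N(dz,dt)-\nu(dz)\,dt$, let $b\in H$, and let $L$ be the $H$-valued Lévy process $$L(t)=tb+\int_0^t\int_{0<\|z\|\le 1}z\,\tilde N(dz,ds)+\int_0^t\int_{\|z\|>1}z\,N(dz,ds),\qquad t\ge 0,$$ where the compensated integral is the limit in $L^2(\Omega;H)$, as $r\downarrow0$, of the integrals over $r<\|z\|\le1$. Write $B(x,r)$ for the open ball and $\overline{B(x,r)}$ for the closed ball with centre $x$ and radius $r$. Assume that for every $h\in H$ and $\eta>0$ there exist $n\ge 1$, numbers $\eta_1,\dots,\eta_n>0$ and $a_1,\dots,a_n\in H\setminus\{0\}$ such that $0\notin\overline{B(a_i,\eta_i)}$ and $\nu(B(a_i,\eta_i))>0$ for $i=1,\dots,n$, and $$\Big\{\sum_{i=1}^n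 h_i:\ h_i\in B(a_i,\eta_i),\ 1\le i\le n\Big\}\subset B(h,\eta).$$ Then $\mathbb P\big(L(s)\in B(h,\varepsilon)\big)>0$ for all $s>0$, $\varepsilon>0$ and $h\in H$; that is, the law of $L(s)$ has full support in $H$ for every $s>0$. -/

import Mathlib

open MeasureTheory ProbabilityTheory Filter
open scoped ENNReal NNReal Topology

namespace LevySupport

noncomputable section

/-- `N` is a Poisson random measure on `E` with intensity measure `m`, defined on the probability
space `(Ω, P)`: a random measure with values in `{0, 1, 2, …, ∞}` such that `N(B)` is Poisson
distributed with parameter `m(B)` (and a.s. equal to `∞` if `m(B) = ∞`), and such that the random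
variables `N(B₁), …, N(Bₙ)` are independent whenever `B₁, …, Bₙ` are pairwise disjoint. -/
structure IsPoissonRandomMeasure {Ω E : Type*} [MeasurableSpace Ω] [MeasurableSpace E]
    (P : Measure Ω) (N : Ω → Measure E) (m : Measure E) : Prop where
  measurable : ∀ B : Set E, MeasurableSet B → Measurable fun ω => N ω B
  integer_valued : ∀ ω, ∀ B : Set E, MeasurableSet B → ∃ k : ℕ∞, N ω B = (k : ℝ≥0∞)
  poisson : ∀ B : Set E, MeasurableSet B → m B ≠ ∞ →
    HasLaw (fun ω => N ω B)
      ((poissonMeasure (m B).toNNReal).map (fun k : ℕ => (k : ℝ≥0∞))) P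
  eq_top : ∀ B : Set E, MeasurableSet B → m B = ∞ → ∀ᵐ ω ∂P, N ω B = ∞
  indep : ∀ (n : ℕ) (B : Fin n → Set E), (∀ i, MeasurableSet (B i)) →
    Pairwise (fun i j => Disjoint (B i) (B j)) → iIndepFun (fun i ω => N ω (B i)) P

/-- A Poisson random measure on `H × [0, ∞)` that is homogeneous in time: its intensity measure is
`ν(dz) dt`. The half line `[0, ∞)` is realized inside `ℝ`, by restricting Lebesgue measure. -/
def IsTimeHomogeneousPRM {Ω H : Type*} [MeasurableSpace Ω] [MeasurableSpace H]
    (P : Measure Ω) (N : Ω → Measure (H × ℝ)) (ν : Measure H) : Prop :=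
  IsPoissonRandomMeasure P N (ν.prod (volume.restrict (Set.Ici (0 : ℝ))))

variable {Ω H : Type*} [MeasurableSpace Ω] [NormedAddCommGroup H] [InnerProductSpace ℝ H]
  [MeasurableSpace H]

/-- The condition characterizing Lévy measures on a Hilbert space:
`ν({0}) = 0` and `∫ (‖z‖² ∧ 1) ν(dz) < ∞`. -/
structure IsLevyMeasure (ν : Measure H) : Prop where
  zero : ν {0} = 0
  lintegral_lt_top : ∫⁻ z, ENNReal.ofReal (min (‖z‖ ^ 2) 1) ∂ν < ∞

/-- `∫₀ᵗ ∫_{‖z‖ > 1} z N(dz, ds)`, a.s. a finite sum. -/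
def bigJumps (N : Ω → Measure (H × ℝ)) (t : ℝ≥0) (ω : Ω) : H :=
  ∫ p in {z : H | 1 < ‖z‖} ×ˢ Set.Ioc (0 : ℝ) t, p.1 ∂(N ω)

/-- `∫₀ᵗ ∫_{r < ‖z‖ ≤ 1} z Ñ(dz, ds)` for `r > 0`, where `Ñ(dz, ds) = N(dz, ds) - ν(dz) ds`.
Since `ν(‖z‖ > r) < ∞`, both terms are ordinary integrals over a set of finite mass (a.s.). -/
def truncatedCompensatedJumps (N : Ω → Measure (H × ℝ)) (ν : Measure H) (r : ℝ) (t : ℝ≥0)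
    (ω : Ω) : H :=
  (∫ p in {z : H | r < ‖z‖ ∧ ‖z‖ ≤ 1} ×ˢ Set.Ioc (0 : ℝ) t, p.1 ∂(N ω))
    - (t : ℝ) • ∫ z in {z : H | r < ‖z‖ ∧ ‖z‖ ≤ 1}, z ∂ν

/-- `M` is (a version of) the compensated integral `∫₀ᵗ ∫_{0 < ‖z‖ ≤ 1} z Ñ(dz, ds)`, `t ≥ 0`:
`M t` is the limit in `L²(Ω, P; H)` of the integrals over `r < ‖z‖ ≤ 1` as `r ↓ 0`. -/
structure IsCompensatedSmallJumps (P : Measure Ω) (N : Ω → Measure (H × ℝ)) (ν : Measure H)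
    (M : ℝ≥0 → Ω → H) : Prop where
  memLp : ∀ t, MemLp (M t) 2 P
  tendsto : ∀ t, Tendsto
    (fun r : ℝ => eLpNorm (fun ω => truncatedCompensatedJumps N ν r t ω - M t ω) 2 P)
    (𝓝[>] 0) (𝓝 0)

/-- `L` is (a version of) the pure jump Lévy process with drift `b` and jumps given by `N`:
`L(t) = t b + ∫₀ᵗ ∫_{0 < ‖z‖ ≤ 1} z Ñ(dz, ds) + ∫₀ᵗ ∫_{‖z‖ > 1} z N(dz, ds)` a.s.,
for every `t ≥ 0`. -/
def IsPureJumpLevyProcess (P : Measure Ω) (N : Ω → Measure (H × ℝ)) (ν : Measure H) (b : H)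
    (L : ℝ≥0 → Ω → H) : Prop :=
  ∃ M : ℝ≥0 → Ω → H, IsCompensatedSmallJumps P N ν M ∧
    ∀ t, ∀ᵐ ω ∂P, L t ω = (t : ℝ) • b + M t ω + bigJumps N t ω

/-- The nondegeneracy condition on the jump measure: every ball `B(h, η)` of `H` contains a sum
`B(a₁, η₁) + ⋯ + B(aₙ, ηₙ)` of `n ≥ 1` balls which have positive `ν`-measure and whose closures
avoid the origin. -/
def JumpsReachEveryBall (ν : Measure H) : Prop :=
  ∀ (h : H) (η₀ : ℝ), 0 < η₀ →
    ∃ (n : ℕ) (η : Fin n → ℝ) (a : Fin n → H), 1 ≤ n ∧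
      (∀ i, 0 < η i) ∧ (∀ i, a i ≠ 0) ∧
      (∀ i, (0 : H) ∉ Metric.closedBall (a i) (η i)) ∧
      (∀ i, 0 < ν (Metric.ball (a i) (η i))) ∧
      {y : H | ∃ x : Fin n → H, (∀ i, x i ∈ Metric.ball (a i) (η i)) ∧ y = ∑ i, x i}
        ⊆ Metric.ball h η₀

end

end LevySupport

/-! The topological support of the law of `L t` is stable under adding any nonzero point `a` of the
support of `ν`. Let `A` be a small ball around `a`. The process without its jumps in `A` is
independent of the number of jumps in `A`, and that number is Poisson with positive parameter. So if
`L t` is near `x` with `k` jumps in `A`, the count `k` may be exchanged for `k + 1` at positive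
probability, and this moves `L t` near `x + a` (`support_add`).

The law has some support point `x`. The hypothesis on `ν`, applied to `h - x`, gives nonzero points
of the support of `ν` whose sum is close to `h - x`. Adding them to `x` one by one reaches the
neighbourhood of `h`.

The independence rests on `indep_countSigma` and on `aestronglyMeasurable_sub_jumpSum`. -/

namespace LevySupport

/-! ### Independence and integrals for Poisson random measures. -/

section PoissonRandomMeasure

variable {Ω E : Type*} [MeasurableSpace Ω] [MeasurableSpace E]

/-- The `σ`-algebra generated by the counts `N(B)` of the measurable sets `B ⊆ C`. -/
@[reducible] def countSigma {Ω E : Type*} [MeasurableSpace E] (N : Ω → Measure E) (C : Set E) :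
    MeasurableSpace Ω :=
  ⨆ B : {B : Set E // MeasurableSet B ∧ B ⊆ C},
    MeasurableSpace.comap (fun ω => N ω B.1) inferInstance

theorem measurable_countSigma {Ω E : Type*} [MeasurableSpace E] (N : Ω → Measure E)
    {C B : Set E} (hB : MeasurableSet B)
    (hBC : B ⊆ C) : Measurable[countSigma N C] fun ω => N ω B :=
  Measurable.of_comap_le
    (le_iSup (fun B : {B : Set E // MeasurableSet B ∧ B ⊆ C} =>
      MeasurableSpace.comap (fun ω => N ω B.1) inferInstance) ⟨B, hB, hBC⟩)

variable {P : Measure Ω} {N : Ω → Measure E} {m : Measure E}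

theorem IsPoissonRandomMeasure.countSigma_le (hN : IsPoissonRandomMeasure P N m) (C : Set E) :
    countSigma N C ≤ ‹MeasurableSpace Ω› :=
  iSup_le fun B => (hN.measurable B.1 B.2.1).comap_le

theorem IsPoissonRandomMeasure.iIndepFun_count (hN : IsPoissonRandomMeasure P N m)
    {ι : Type*} [Fintype ι] (B : ι → Set E) (hB : ∀ i, MeasurableSet (B i))
    (hd : Pairwise fun i j => Disjoint (B i) (B j)) : iIndepFun (fun i ω => N ω (B i)) P := by
  let e := Fintype.equivFin ι
  have h := hN.indep _ (fun i => B (e.symm i)) (fun i => hB _)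
    (fun i j hij => hd (fun h => hij (e.symm.injective h)))
  have h' := h.precomp e.injective
  simpa using h'

/-- A finite family of subsets of `C` cuts `C` into disjoint atoms. These and `D` have independent
counts, and the count of each member is the sum over the atoms it contains. -/
theorem IsPoissonRandomMeasure.indep_finset (hN : IsPoissonRandomMeasure P N m)
    [IsProbabilityMeasure P] {C D : Set E}
    (hC : MeasurableSet C) (hD : MeasurableSet D) (hCD : Disjoint C D)
    (F : Finset {B : Set E // MeasurableSet B ∧ B ⊆ C}) :
    Indep (⨆ B ∈ F, MeasurableSpace.comap (fun ω => N ω B.1) inferInstance)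
      (MeasurableSpace.comap (fun ω => N ω D) inferInstance) P := by
  classical
  let atom : Finset F → Set E := fun T => C ∩ ⋂ B : F, {x | x ∈ B.1.1 ↔ B ∈ T}
  have hatom : ∀ T, MeasurableSet (atom T) := by
    intro T
    refine hC.inter (MeasurableSet.iInter fun B => ?_)
    by_cases hBT : B ∈ T
    · convert B.1.2.1 using 1
      ext x; simp [hBT]
    · convert B.1.2.1.compl using 1
      ext x; simp [hBT]
  have hdisj : ∀ S T : Finset F, S ≠ T → Disjoint (atom S) (atom T) := by
    intro S T hST
    rw [Set.disjoint_left]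
    rintro x ⟨-, hS⟩ ⟨-, hT⟩
    apply hST
    ext B
    simp only [Set.mem_iInter, Set.mem_ofPred_eq] at hS hT
    rw [← hS B, ← hT B]
  let G : Option (Finset F) → Set E := fun o => o.elim D atom
  have hG : ∀ o, MeasurableSet (G o) := by
    rintro (_ | T)
    · exact hD
    · exact hatom T
  have hGd : Pairwise fun i j => Disjoint (G i) (G j) := by
    rintro (_ | S) (_ | T) h
    · exact absurd rfl h
    · exact (hCD.mono_left Set.inter_subset_left).symm
    · exact hCD.mono_left Set.inter_subset_left
    · exact hdisj S T (fun h' => h (by rw [h']))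
  have hind := (hN.iIndepFun_count G hG hGd)
  rw [iIndepFun_iff_iIndep] at hind
  have h2 := indep_iSup_of_disjoint (fun o => (hN.measurable (G o) (hG o)).comap_le) hind
    (S := Set.range some) (T := {none}) (by simp)
  refine indep_of_indep_of_le_left (indep_of_indep_of_le_right h2 ?_) ?_
  · exact le_iSup₂_of_le none rfl le_rfl
  · refine iSup₂_le fun B hB => ?_
    rw [← measurable_iff_comap_le]
    have hsum : (fun ω => N ω B.1) =
        fun ω => ∑ T : Finset F with (⟨B, hB⟩ : F) ∈ T, N ω (G (some T)) := by
      ext ω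
      change N ω B.1 = ∑ T : Finset F with (⟨B, hB⟩ : F) ∈ T, N ω (atom T)
      rw [← measure_biUnion_finset (fun S _ T _ h => hdisj S T h) (fun T _ => hatom T)]
      congr 1
      ext x
      simp only [Set.mem_iUnion, Finset.mem_filter, Finset.mem_univ, true_and, exists_prop]
      constructor
      · intro hx
        refine ⟨Finset.univ.filter fun B' : F => x ∈ B'.1.1, by simpa using hx, B.2.2 hx, ?_⟩
        simp
      · rintro ⟨T, hT, -, hx⟩
        simp only [Set.mem_iInter, Set.mem_ofPred_eq] at hx
        exact (hx ⟨B, hB⟩).2 hT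
    rw [hsum]
    refine Finset.measurable_sum _ fun T _ => Measurable.of_comap_le ?_
    exact le_iSup₂_of_le (f := fun o (_ : o ∈ Set.range some) =>
      MeasurableSpace.comap (fun ω => N ω (G o)) inferInstance) (some T) ⟨T, rfl⟩ le_rfl

theorem IsPoissonRandomMeasure.indep_countSigma (hN : IsPoissonRandomMeasure P N m)
    [IsProbabilityMeasure P] {C D : Set E}
    (hC : MeasurableSet C) (hD : MeasurableSet D) (hCD : Disjoint C D) :
    Indep (countSigma N C) (MeasurableSpace.comap (fun ω => N ω D) inferInstance) P := by
  rw [countSigma, iSup_eq_iSup_finset]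
  refine indep_iSup_of_directed_le (fun F => hN.indep_finset hC hD hCD F)
    (fun F => iSup₂_le fun B _ => (hN.measurable B.1 B.2.1).comap_le)
    (hN.measurable D hD).comap_le ?_
  exact Monotone.directed_le fun F G hFG => biSup_mono fun B hB => Finset.mem_of_subset hFG hB

theorem IsPoissonRandomMeasure.ae_lt_top (hN : IsPoissonRandomMeasure P N m) {B : Set E}
    (hB : MeasurableSet B) (hm : m B ≠ ∞) : ∀ᵐ ω ∂P, N ω B < ∞ := by
  have h := (hN.poisson B hB hm).ae_iff (p := fun x : ℝ≥0∞ => x < ∞)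
    (measurableSet_setOfPred.1 measurableSet_Iio)
  rw [h, ae_map_iff (by fun_prop) measurableSet_Iio]
  exact ae_of_all _ fun k => ENNReal.natCast_lt_top k

/-- A Poisson law of positive parameter charges every integer; 0 is charged even when the parameter
vanishes. -/
theorem IsPoissonRandomMeasure.measure_count_eq_pos (hN : IsPoissonRandomMeasure P N m) {B : Set E}
    (hB : MeasurableSet B) (hm : m B ≠ ∞) (k : ℕ) (hk : k = 0 ∨ m B ≠ 0) :
    0 < P {ω | N ω B = k} := by
  have hs : MeasurableSet {x : ℝ≥0∞ | x = k} := measurableSet_singleton _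
  rw [(hN.poisson B hB hm).measure_eq (p := fun x : ℝ≥0∞ => x = k) hs,
    Measure.map_apply (by fun_prop) hs]
  have : (fun k : ℕ => (k : ℝ≥0∞)) ⁻¹' {x | x = k} = {k} := by
    ext j; simp
  rw [this, poissonMeasure_singleton, ENNReal.ofReal_pos]
  rcases hk with rfl | hk
  · simp [Real.exp_pos]
  · have : 0 < ((m B).toNNReal : ℝ) := by
      simpa using ENNReal.toNNReal_pos hk hm
    positivity

/-- Here `P` lives on a σ-algebra other than `m₁`, so the exceptional null sets need not be in `m₁`;
the limit is taken of `m₁`-measurable versions. -/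
theorem aestronglyMeasurable_of_tendsto_ae_of_sub {F : Type*} [NormedAddCommGroup F]
    [CompleteSpace F] {m₁ : MeasurableSpace Ω} {f : ℕ → Ω → F} {g : Ω → F}
    (hf : ∀ n, AEStronglyMeasurable[m₁] (f n) P)
    (hg : ∀ᵐ ω ∂P, Tendsto (fun n => f n ω) atTop (𝓝 (g ω))) :
    AEStronglyMeasurable[m₁] g P := by
  refine ⟨fun ω => limUnder atTop fun n => (hf n).mk _ ω,
    StronglyMeasurable.limUnder fun n => (hf n).stronglyMeasurable_mk, ?_⟩
  filter_upwards [hg, ae_all_iff.2 fun n => (hf n).ae_eq_mk] with ω hω h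
  simp_rw [h] at hω
  exact hω.limUnder_eq.symm

/-- The integral of a simple function is a finite combination of counts of subsets of `C`. -/
theorem aestronglyMeasurable_setIntegral_countSigma {F : Type*} [NormedAddCommGroup F]
    [NormedSpace ℝ F] [CompleteSpace F] [SecondCountableTopology F] [MeasurableSpace F]
    [BorelSpace F] {f : E → F} (hf : Measurable f) {C D : Set E} (hC : MeasurableSet C)
    (hCD : C ⊆ D) (hint : ∀ᵐ ω ∂P, IntegrableOn f C (N ω)) :
    AEStronglyMeasurable[countSigma N D] (fun ω => ∫ x in C, f x ∂N ω) P := by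
  classical
  let φ := SimpleFunc.approxOn f hf Set.univ 0 (Set.mem_univ _)
  refine aestronglyMeasurable_of_tendsto_ae_of_sub
    (f := fun n ω => (φ n).integral ((N ω).restrict C)) (fun n => ?_) ?_
  · refine StronglyMeasurable.aestronglyMeasurable ?_
    simp_rw [SimpleFunc.integral_def, SimpleFunc.setToSimpleFunc, weightedSMul_apply,
      measureReal_def, Measure.restrict_apply ((φ n).measurableSet_fiber _)]
    refine Finset.stronglyMeasurable_fun_sum _ fun y _ => ?_
    refine StronglyMeasurable.smul_const ?_ y
    refine Measurable.stronglyMeasurable ?_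
    exact (measurable_countSigma N (((φ n).measurableSet_fiber y).inter hC)
      (Set.inter_subset_right.trans hCD)).ennreal_toReal
  · filter_upwards [hint] with ω hω
    exact tendsto_integral_approxOn_of_measurable hω hf (ae_of_all _ fun _ => by simp) _
      (integrable_zero _ _ _)

/-- The measures of the sets `{‖f‖ > n} ∩ C` decrease to 0, and being integers they are eventually
0. -/
theorem exists_ae_norm_le_of_integer_valued {E F : Type*} [MeasurableSpace E] [NormedAddCommGroup F]
    [MeasurableSpace F] [BorelSpace F] {μ : Measure E}
    (hμ : ∀ B, MeasurableSet B → ∃ k : ℕ∞, μ B = (k : ℝ≥0∞))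
    {f : E → F} (hf : Measurable f) {C : Set E} (hC : MeasurableSet C) (hfin : μ C ≠ ∞) :
    ∃ K : ℝ, ∀ᵐ x ∂μ.restrict C, ‖f x‖ ≤ K := by
  let S : ℕ → Set E := fun n => C ∩ {x | (n : ℝ) < ‖f x‖}
  have hS : ∀ n, MeasurableSet (S n) := fun n =>
    hC.inter (measurableSet_lt measurable_const hf.norm)
  have hanti : Antitone S := fun n k hnk x hx =>
    ⟨hx.1, show (n : ℝ) < ‖f x‖ from lt_of_le_of_lt (Nat.cast_le.2 hnk) hx.2⟩
  have hlim := tendsto_measure_iInter_atTop (μ := μ) (fun n => (hS n).nullMeasurableSet) hanti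
    ⟨0, ne_top_of_le_ne_top hfin (measure_mono Set.inter_subset_left)⟩
  have hempty : ⋂ n, S n = ∅ := by
    ext x
    simp only [Set.mem_iInter, Set.mem_empty_iff_false, iff_false, not_forall]
    obtain ⟨n, hn⟩ := exists_nat_ge ‖f x‖
    exact ⟨n, fun h => absurd h.2 (not_lt.2 hn)⟩
  rw [hempty, measure_empty] at hlim
  obtain ⟨n, hn⟩ := (hlim.eventually_lt_const (show (0 : ℝ≥0∞) < 1 by norm_num)).exists
  have hzero : μ (S n) = 0 := by
    obtain ⟨k, hk⟩ := hμ _ (hS n)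
    simp only [Function.comp_apply] at hn
    rw [hk] at hn ⊢
    have : k < 1 := by exact_mod_cast hn
    simp [Order.lt_one_iff.1 this]
  refine ⟨n, ?_⟩
  rw [ae_restrict_iff' hC, ae_iff]
  refine measure_mono_null (fun x hx => ?_) hzero
  simp only [Set.mem_ofPred_eq, Classical.not_imp, not_le] at hx
  exact hx

theorem IsPoissonRandomMeasure.ae_integrableOn (hN : IsPoissonRandomMeasure P N m) {F : Type*}
    [NormedAddCommGroup F] [SecondCountableTopology F] [MeasurableSpace F] [BorelSpace F]
    {f : E → F} (hf : Measurable f) {C : Set E} (hC : MeasurableSet C) (hm : m C ≠ ∞) :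
    ∀ᵐ ω ∂P, IntegrableOn f C (N ω) := by
  filter_upwards [hN.ae_lt_top hC hm] with ω hω
  obtain ⟨K, hK⟩ := exists_ae_norm_le_of_integer_valued (hN.integer_valued ω) hf hC hω.ne
  exact IntegrableOn.of_bound hω hf.aestronglyMeasurable K hK

end PoissonRandomMeasure

/-! ### Removing the jumps in a set away from the origin. -/

section LevyProcess

variable {Ω H : Type*} [MeasurableSpace Ω] [NormedAddCommGroup H] [InnerProductSpace ℝ H]
  [MeasurableSpace H]

/-- The sum `∫₀ᵗ ∫_A z N(dz, ds)` of the jumps with values in `A`. -/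
noncomputable def jumpSum {Ω H : Type*} [NormedAddCommGroup H] [InnerProductSpace ℝ H]
    [MeasurableSpace H] (N : Ω → Measure (H × ℝ)) (A : Set H) (t : ℝ≥0) (ω : Ω) : H :=
  ∫ p in A ×ˢ Set.Ioc (0 : ℝ) t, p.1 ∂(N ω)

theorem prod_Ioc_apply {H : Type*} [MeasurableSpace H] (ν : Measure H) (A : Set H) (t : ℝ≥0) :
    (ν.prod (volume.restrict (Set.Ici (0 : ℝ)))) (A ×ˢ Set.Ioc (0 : ℝ) t) = ν A * t := by
  rw [Measure.prod_prod, Measure.restrict_apply measurableSet_Ioc,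
    Set.inter_eq_left.2 (fun x hx => hx.1.le), Real.volume_Ioc, sub_zero,
    ENNReal.ofReal_coe_nnreal]

/-- Each of the `k` jumps differs from `a` by at most `η`. -/
theorem norm_jumpSum_sub_le {Ω H : Type*} [NormedAddCommGroup H] [InnerProductSpace ℝ H]
    [CompleteSpace H] [MeasurableSpace H] {N : Ω → Measure (H × ℝ)} {A : Set H} {t : ℝ≥0}
    {ω : Ω} {a : H} {η : ℝ} {k : ℕ}
    (hA : A ⊆ Metric.ball a η)
    (hint : IntegrableOn Prod.fst (A ×ˢ Set.Ioc (0 : ℝ) t) (N ω))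
    (hk : N ω (A ×ˢ Set.Ioc (0 : ℝ) t) = k) : ‖jumpSum N A t ω - k • a‖ ≤ η * k := by
  have hfin : N ω (A ×ˢ Set.Ioc (0 : ℝ) t) < ∞ := by simp [hk]
  have hreal : (N ω).real (A ×ˢ Set.Ioc (0 : ℝ) t) = k := by simp [measureReal_def, hk]
  have h := norm_setIntegral_le_of_norm_le_const (f := fun p : H × ℝ => p.1 - a) hfin
    (C := η) (fun p hp => (mem_ball_iff_norm.1 (hA hp.1)).le)
  rw [integral_sub hint (integrableOn_const hfin.ne), setIntegral_const, hreal] at h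
  simpa [jumpSum, Nat.cast_smul_eq_nsmul] using h

variable [BorelSpace H]

theorem measurableSet_lt_norm {H : Type*} [NormedAddCommGroup H] [MeasurableSpace H]
    [BorelSpace H] (r : ℝ) : MeasurableSet {z : H | r < ‖z‖} :=
  measurableSet_lt measurable_const measurable_norm

theorem IsLevyMeasure.measure_lt_norm_lt_top {H : Type*} [NormedAddCommGroup H]
    [MeasurableSpace H] [BorelSpace H] {ν : Measure H} (hν : IsLevyMeasure ν) {r : ℝ}
    (hr : 0 < r) : ν {z : H | r < ‖z‖} < ∞ := by
  have hc : 0 < min (r ^ 2) 1 := by positivity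
  have hmeas : Measurable fun z : H => ENNReal.ofReal (min (‖z‖ ^ 2) 1) := by fun_prop
  have h := meas_ge_le_lintegral_div (μ := ν) hmeas.aemeasurable
    (ENNReal.ofReal_pos.2 hc).ne' ENNReal.ofReal_ne_top
  refine lt_of_le_of_lt (measure_mono fun z hz => ?_)
    (h.trans_lt (ENNReal.div_lt_top hν.lintegral_lt_top.ne (ENNReal.ofReal_pos.2 hc).ne'))
  have hz' : r < ‖z‖ := hz
  change ENNReal.ofReal _ ≤ ENNReal.ofReal _
  gcongr

variable [SecondCountableTopology H] {P : Measure Ω} {N : Ω → Measure (H × ℝ)} {ν : Measure H}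

theorem IsTimeHomogeneousPRM.ae_integrableOn_fst (hN : IsTimeHomogeneousPRM P N ν) {A : Set H}
    (hA : MeasurableSet A) (hνA : ν A ≠ ∞) (t : ℝ≥0) :
    ∀ᵐ ω ∂P, IntegrableOn Prod.fst (A ×ˢ Set.Ioc (0 : ℝ) t) (N ω) := by
  refine IsPoissonRandomMeasure.ae_integrableOn hN measurable_fst (hA.prod measurableSet_Ioc) ?_
  rw [prod_Ioc_apply]
  exact ENNReal.mul_ne_top hνA ENNReal.coe_ne_top

theorem IsTimeHomogeneousPRM.ae_jumpSum_eq_add (hN : IsTimeHomogeneousPRM P N ν) {A B : Set H}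
    (hA : MeasurableSet A) (hB : MeasurableSet B) (hAB : A ⊆ B) (hνB : ν B ≠ ∞) (t : ℝ≥0) :
    ∀ᵐ ω ∂P, jumpSum N B t ω = jumpSum N A t ω + jumpSum N (B \ A) t ω := by
  filter_upwards [hN.ae_integrableOn_fst hB hνB t] with ω hω
  simp only [jumpSum]
  rw [← setIntegral_union, ← Set.union_prod, Set.union_sdiff_cancel hAB]
  · exact Set.disjoint_prod.2 (Or.inl Set.disjoint_sdiff_right)
  · exact (hB.diff hA).prod measurableSet_Ioc
  · exact hω.mono_set (Set.prod_mono hAB subset_rfl)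
  · exact hω.mono_set (Set.prod_mono Set.sdiff_subset subset_rfl)

theorem IsTimeHomogeneousPRM.ae_truncated_add_bigJumps (hN : IsTimeHomogeneousPRM P N ν)
    (hν : IsLevyMeasure ν) {r : ℝ} (hr : 0 < r) (hr1 : r ≤ 1) (t : ℝ≥0) :
    ∀ᵐ ω ∂P, truncatedCompensatedJumps N ν r t ω + bigJumps N t ω =
      jumpSum N {z | r < ‖z‖} t ω - (t : ℝ) • ∫ z in {z : H | r < ‖z‖ ∧ ‖z‖ ≤ 1}, z ∂ν := by
  filter_upwards [hN.ae_jumpSum_eq_add (measurableSet_lt_norm 1) (measurableSet_lt_norm r)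
    (fun z (hz : 1 < ‖z‖) => hr1.trans_lt hz) (hν.measure_lt_norm_lt_top hr).ne t] with ω hω
  have hset : {z : H | r < ‖z‖} \ {z : H | 1 < ‖z‖} = {z : H | r < ‖z‖ ∧ ‖z‖ ≤ 1} := by
    ext z; simp
  rw [hω, hset]
  simp only [truncatedCompensatedJumps, bigJumps, jumpSum]
  abel

variable [CompleteSpace H] {L : ℝ≥0 → Ω → H} {b : H}

/-- The process without its jumps in a set `A` away from the origin is a functional of the jumps
outside of `A`. -/
theorem IsPureJumpLevyProcess.aestronglyMeasurable_sub_jumpSum [IsProbabilityMeasure P]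
    (hν : IsLevyMeasure ν) (hN : IsTimeHomogeneousPRM P N ν) (hL : IsPureJumpLevyProcess P N ν b L)
    {A : Set H} (hA : MeasurableSet A) {ρ : ℝ} (hρ : 0 < ρ) (hAρ : A ⊆ {z | ρ < ‖z‖}) (t : ℝ≥0) :
    AEStronglyMeasurable[countSigma N (A ×ˢ Set.Ioc (0 : ℝ) t)ᶜ]
      (fun ω => L t ω - jumpSum N A t ω) P := by
  obtain ⟨M, hM, hLM⟩ := hL
  -- Cutoffs below `ρ` retain all jumps in `A`; cutoffs below 1 allow the truncated and big jumps to
  -- be merged.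
  let r : ℕ → ℝ := fun n => min ρ 1 / (n + 1)
  have hrpos : ∀ n, 0 < r n := fun n => by positivity
  have hrle : ∀ n, r n ≤ min ρ 1 := fun n =>
    div_le_self (by positivity) (by have := n.cast_nonneg (α := ℝ); linarith)
  have hr0 : Tendsto r atTop (𝓝[>] 0) := by
    refine tendsto_nhdsWithin_iff.2 ⟨?_, Eventually.of_forall hrpos⟩
    have := tendsto_one_div_add_atTop_nhds_zero_nat (𝕜 := ℝ).const_mul (min ρ 1)
    simpa [r, div_eq_mul_inv] using this
  have hsum : ∀ (D : Set (H × ℝ)) (B : Set H), MeasurableSet B → ν B ≠ ∞ →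
      B ×ˢ Set.Ioc (0 : ℝ) t ⊆ D →
      AEStronglyMeasurable[countSigma N D] (fun ω => jumpSum N B t ω) P := fun D B hB hνB hBD =>
    aestronglyMeasurable_setIntegral_countSigma measurable_fst (hB.prod measurableSet_Ioc) hBD
      (hN.ae_integrableOn_fst hB hνB t)
  have hTmeas : ∀ n, AEStronglyMeasurable (fun ω => truncatedCompensatedJumps N ν (r n) t ω) P := by
    intro n
    refine AEStronglyMeasurable.sub ?_ aestronglyMeasurable_const
    have hset : {z : H | r n < ‖z‖ ∧ ‖z‖ ≤ 1} = {z | r n < ‖z‖} \ {z | 1 < ‖z‖} := by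
      ext z; simp
    refine (hsum Set.univ {z : H | r n < ‖z‖ ∧ ‖z‖ ≤ 1} ?_ ?_ (Set.subset_univ _)).mono
      (IsPoissonRandomMeasure.countSigma_le hN _)
    · rw [hset]
      exact (measurableSet_lt_norm _).diff (measurableSet_lt_norm _)
    · exact ((measure_mono fun z hz => hz.1).trans_lt
        (hν.measure_lt_norm_lt_top (hrpos n))).ne
  have hmeas : TendstoInMeasure P (fun n ω => truncatedCompensatedJumps N ν (r n) t ω) atTop
      (M t) :=
    -- Convergence in L² gives almost sure convergence only along a subsequence, which suffices for
    -- measurability.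
    tendstoInMeasure_of_tendsto_eLpNorm two_ne_zero hTmeas (hM.memLp t).1
      ((hM.tendsto t).comp hr0)
  obtain ⟨ns, -, hns⟩ := hmeas.exists_seq_tendsto_ae
  refine aestronglyMeasurable_of_tendsto_ae_of_sub
    (f := fun n ω => (t : ℝ) • b + (jumpSum N ({z | r (ns n) < ‖z‖} \ A) t ω -
      (t : ℝ) • ∫ z in {z : H | r (ns n) < ‖z‖ ∧ ‖z‖ ≤ 1}, z ∂ν)) (fun n => ?_) ?_
  · refine AEStronglyMeasurable.add aestronglyMeasurable_const
      (AEStronglyMeasurable.sub ?_ aestronglyMeasurable_const)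
    refine hsum _ _ ((measurableSet_lt_norm _).diff hA) ?_ ?_
    · exact ((measure_mono Set.sdiff_subset).trans_lt
        (hν.measure_lt_norm_lt_top (hrpos (ns n)))).ne
    · exact fun p hp hp' => hp.1.2 hp'.1
  · have hsplit := ae_all_iff.2 fun n => hN.ae_jumpSum_eq_add hA (measurableSet_lt_norm (r n))
      (fun z hz => ((hrle n).trans (min_le_left _ _)).trans_lt (hAρ hz))
      (hν.measure_lt_norm_lt_top (hrpos n)).ne t
    have htrunc := ae_all_iff.2 fun n => hN.ae_truncated_add_bigJumps hν (hrpos n)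
      ((hrle n).trans (min_le_right _ _)) t
    filter_upwards [hns, hLM t, hsplit, htrunc] with ω h1 h2 h3 h4
    have h5 := ((h1.const_add ((t : ℝ) • b)).add_const (bigJumps N t ω)).sub_const
      (jumpSum N A t ω)
    rw [h2]
    refine h5.congr fun n => ?_
    rw [add_assoc, h4, h3]
    abel

/-- Conditioning on the number of jumps in `A` does not affect the rest of the process. -/
theorem IsPureJumpLevyProcess.measure_sub_jumpSum_mem_and_count_pos [IsProbabilityMeasure P]
    (hν : IsLevyMeasure ν) (hN : IsTimeHomogeneousPRM P N ν) (hL : IsPureJumpLevyProcess P N ν b L)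
    {A : Set H} (hA : MeasurableSet A) {ρ : ℝ} (hρ : 0 < ρ) (hAρ : A ⊆ {z | ρ < ‖z‖}) {t : ℝ≥0}
    (ht : 0 < t) {U : Set H} (hU : MeasurableSet U)
    (hpos : P {ω | L t ω - jumpSum N A t ω ∈ U} ≠ 0) (k : ℕ) (hk : k = 0 ∨ ν A ≠ 0) :
    P {ω | L t ω - jumpSum N A t ω ∈ U ∧ N ω (A ×ˢ Set.Ioc (0 : ℝ) t) = k} ≠ 0 := by
  have hX := hL.aestronglyMeasurable_sub_jumpSum hν hN hA hρ hAρ t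
  have hAt : MeasurableSet (A ×ˢ Set.Ioc (0 : ℝ) t) := hA.prod measurableSet_Ioc
  have hindep := (Indep_iff _ _ _).1 (IsPoissonRandomMeasure.indep_countSigma hN hAt.compl hAt
    disjoint_compl_left)
  have hνA : ν A ≠ ∞ := ((measure_mono hAρ).trans_lt (hν.measure_lt_norm_lt_top hρ)).ne
  have hN0 := IsPoissonRandomMeasure.measure_count_eq_pos hN hAt
    (by rw [prod_Ioc_apply]; exact ENNReal.mul_ne_top hνA ENNReal.coe_ne_top) k
    (hk.imp_right fun h => by
      rw [prod_Ioc_apply]; exact mul_ne_zero h (by exact_mod_cast ht.ne'))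
  -- Independence applies to the version measurable with respect to the counts outside `A`; the
  -- null-set corrections follow.
  have hprod := hindep (hX.mk _ ⁻¹' U) {ω | N ω (A ×ˢ Set.Ioc (0 : ℝ) t) = k}
    (hX.stronglyMeasurable_mk.measurable hU) ⟨{(k : ℝ≥0∞)}, measurableSet_singleton _, rfl⟩
  have h1 : P {ω | L t ω - jumpSum N A t ω ∈ U ∧ N ω (A ×ˢ Set.Ioc (0 : ℝ) t) = k} =
      P (hX.mk _ ⁻¹' U ∩ {ω | N ω (A ×ˢ Set.Ioc (0 : ℝ) t) = k}) := by
    refine measure_congr ?_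
    filter_upwards [hX.ae_eq_mk] with ω hω
    change (_ ∈ U ∧ _) = (_ ∈ U ∧ _)
    rw [hω]
    rfl
  have h2 : P {ω | L t ω - jumpSum N A t ω ∈ U} = P (hX.mk _ ⁻¹' U) := by
    refine measure_congr ?_
    filter_upwards [hX.ae_eq_mk] with ω hω
    change (_ ∈ U) = (_ ∈ U)
    rw [hω]
  rw [h1, hprod]
  exact mul_ne_zero (h2 ▸ hpos) hN0.ne'

end LevyProcess

/-! ### The support of the law of `L t`. -/

section Support

/-- By second countability, a set of nonzero measure meets the topological support. -/
theorem exists_mem_ball_forall_measure_ball_ne_zero {X : Type*} [PseudoMetricSpace X]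
    [SecondCountableTopology X] [MeasurableSpace X] {μ : Measure X} {x : X} {δ : ℝ}
    (h : μ (Metric.ball x δ) ≠ 0) :
    ∃ y ∈ Metric.ball x δ, ∀ η : ℝ, 0 < η → μ (Metric.ball y η) ≠ 0 := by
  obtain ⟨y, hy, hpos⟩ := exists_mem_forall_mem_nhdsWithin_pos_measure h
  exact ⟨y, hy, fun η hη =>
    (hpos _ (mem_nhdsWithin_of_mem_nhds (Metric.ball_mem_nhds y hη))).ne'⟩

variable {Ω H : Type*} [MeasurableSpace Ω] [NormedAddCommGroup H] [InnerProductSpace ℝ H]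
  [MeasurableSpace H] [BorelSpace H] [SecondCountableTopology H] [CompleteSpace H]
  {P : Measure Ω} [IsProbabilityMeasure P] {N : Ω → Measure (H × ℝ)} {ν : Measure H}
  {L : ℝ≥0 → Ω → H} {b : H}

theorem IsPureJumpLevyProcess.aemeasurable (hν : IsLevyMeasure ν)
    (hN : IsTimeHomogeneousPRM P N ν) (hL : IsPureJumpLevyProcess P N ν b L) (t : ℝ≥0) :
    AEMeasurable (L t) P := by
  have h := hL.aestronglyMeasurable_sub_jumpSum hν hN MeasurableSet.empty one_pos
    (Set.empty_subset _) t
  simpa [jumpSum] using (h.mono (IsPoissonRandomMeasure.countSigma_le hN _)).aemeasurable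

/-- With positive probability there are no jumps larger than some `r`, and the rest of the process
is close to a constant. -/
theorem IsPureJumpLevyProcess.exists_measure_ball_ne_zero (hν : IsLevyMeasure ν)
    (hN : IsTimeHomogeneousPRM P N ν) (hL : IsPureJumpLevyProcess P N ν b L) {t : ℝ≥0} (ht : 0 < t)
    {δ : ℝ} (hδ : 0 < δ) : ∃ x, P {ω | L t ω ∈ Metric.ball x δ} ≠ 0 := by
  have hL' := hL
  obtain ⟨M, hM, hLM⟩ := hL'
  obtain ⟨r, hr, hr0, hr1⟩ := (((hM.tendsto t).eventually_lt_const
    (ENNReal.ofReal_pos.2 hδ)).and (Ioo_mem_nhdsGT (one_pos (α := ℝ)))).exists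
  -- Otherwise the distance would be at least `δ` almost surely, and so would its L² norm.
  have hclose : P {ω | ‖truncatedCompensatedJumps N ν r t ω - M t ω‖ < δ} ≠ 0 := by
    intro h0
    refine absurd hr (not_lt.2 ?_)
    have hae : ∀ᵐ ω ∂P, ‖δ‖ ≤ ‖truncatedCompensatedJumps N ν r t ω - M t ω‖ := by
      rw [ae_iff]
      simpa [abs_of_pos hδ] using h0
    have := eLpNorm_mono_ae (p := 2) (f := fun _ : Ω => δ) hae
    refine le_trans (le_of_eq ?_) this
    rw [eLpNorm_const _ two_ne_zero (IsProbabilityMeasure.ne_zero P)]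
    simp [Real.enorm_eq_ofReal hδ.le]
  set A : Set H := {z | r < ‖z‖} with hAdef
  have hA : MeasurableSet A := measurableSet_lt_norm r
  set x : H := (t : ℝ) • b - (t : ℝ) • ∫ z in {z : H | r < ‖z‖ ∧ ‖z‖ ≤ 1}, z ∂ν with hx
  have hball : P {ω | L t ω - jumpSum N A t ω ∈ Metric.ball x δ} ≠ 0 := by
    convert hclose using 1
    refine measure_congr ?_
    filter_upwards [hLM t, hN.ae_truncated_add_bigJumps hν hr0 hr1.le t] with ω h1 h2
    change (_ ∈ Metric.ball x δ) = (_ < δ)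
    rw [mem_ball_iff_norm', h1, hx]
    have h3 : jumpSum N A t ω = truncatedCompensatedJumps N ν r t ω + bigJumps N t ω +
        (t : ℝ) • ∫ z in {z : H | r < ‖z‖ ∧ ‖z‖ ≤ 1}, z ∂ν := by
      rw [h2]; abel
    rw [h3]
    congr 2
    abel
  have h := hL.measure_sub_jumpSum_mem_and_count_pos hν hN hA hr0 subset_rfl ht
    Metric.isOpen_ball.measurableSet hball 0 (Or.inl rfl)
  refine ⟨x, fun h0 => h (measure_mono_null ?_ h0)⟩
  rintro ω ⟨h1, h2⟩
  have h3 : jumpSum N A t ω = 0 := setIntegral_measure_zero _ (by simpa using h2)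
  simpa [h3] using h1

/-- The topological support of the law of `L(t)` is stable under translation by the nonzero points
of the support of the jump measure. -/
theorem IsPureJumpLevyProcess.support_add (hν : IsLevyMeasure ν)
    (hN : IsTimeHomogeneousPRM P N ν) (hL : IsPureJumpLevyProcess P N ν b L) {t : ℝ≥0} (ht : 0 < t)
    {x a : H} (ha : a ≠ 0) (hx : ∀ δ : ℝ, 0 < δ → P {ω | L t ω ∈ Metric.ball x δ} ≠ 0)
    (hνa : ∀ η : ℝ, 0 < η → ν (Metric.ball a η) ≠ 0) {ε : ℝ} (hε : 0 < ε) :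
    P {ω | L t ω ∈ Metric.ball (x + a) ε} ≠ 0 := by
  set I := Set.Ioc (0 : ℝ) t with hI
  set ρ := ‖a‖ / 2 with hρdef
  have hna : 0 < ‖a‖ := norm_pos_iff.2 ha
  have hρ : 0 < ρ := by positivity
  have hfar : ∀ η ≤ ρ, Metric.ball a η ⊆ {z | ρ < ‖z‖} := by
    intro η hη z hz
    rw [mem_ball_iff_norm'] at hz
    have := norm_sub_norm_le a z
    change ρ < ‖z‖
    linarith
  have hfinite : ∀ η ≤ ρ, ν (Metric.ball a η) ≠ ∞ := fun η hη =>
    ((measure_mono (hfar η hη)).trans_lt (hν.measure_lt_norm_lt_top hρ)).ne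
  have hball : ∀ (y : H) (η : ℝ), MeasurableSet (Metric.ball y η) := fun y η =>
    Metric.isOpen_ball.measurableSet
  -- The jumps are bounded by `K` on the fixed ball of radius `ρ` before `η` is chosen. The bound
  -- passes to the smaller ball, so `η` may depend on `K` without circularity.
  obtain ⟨K, hK⟩ : ∃ K : ℕ, P {ω | L t ω ∈ Metric.ball x (ε / 4) ∧
      N ω (Metric.ball a ρ ×ˢ I) ≤ K} ≠ 0 := by
    by_contra! h
    refine hx (ε / 4) (by positivity) (measure_mono_null_ae ?_ (measure_iUnion_null h))
    have hlt : ∀ᵐ ω ∂P, N ω (Metric.ball a ρ ×ˢ I) < ∞ := IsPoissonRandomMeasure.ae_lt_top hN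
      ((hball a ρ).prod measurableSet_Ioc)
      (by rw [prod_Ioc_apply]; exact ENNReal.mul_ne_top (hfinite ρ le_rfl) ENNReal.coe_ne_top)
    filter_upwards [hlt] with ω hω hLω
    obtain ⟨K, hK⟩ := ENNReal.exists_nat_gt hω.ne
    exact Set.mem_iUnion.2 ⟨K, hLω, hK.le⟩
  set η := min ρ (ε / 4 / (K + 1)) with hη
  have hηpos : 0 < η := by positivity
  have hηρ : η ≤ ρ := min_le_left _ _
  -- The factor `K + 1` leaves room for the one additional jump.
  have hηK : η * (K + 1) ≤ ε / 4 := by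
    rw [← le_div_iff₀ (by positivity)]
    exact min_le_right _ _
  set A := Metric.ball a η with hAdef
  have hint := hN.ae_integrableOn_fst (hball a η) (hfinite η hηρ) t
  obtain ⟨k, hkK, hk⟩ : ∃ k : ℕ, k ≤ K ∧ P {ω | L t ω ∈ Metric.ball x (ε / 4) ∧
      N ω (A ×ˢ I) = k} ≠ 0 := by
    by_contra! h
    refine hK (measure_mono_null ?_ ((measure_biUnion_null_iff (Set.to_countable {k | k ≤ K})).2 h))
    rintro ω ⟨hLω, hle⟩
    obtain ⟨k, hk⟩ := IsPoissonRandomMeasure.integer_valued hN ω (A ×ˢ I)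
      ((hball a η).prod measurableSet_Ioc)
    have hle' : N ω (A ×ˢ I) ≤ K :=
      (measure_mono (Set.prod_mono (Metric.ball_subset_ball hηρ) subset_rfl)).trans hle
    rw [hk] at hle'
    have hkK : k ≤ K := by exact_mod_cast hle'
    lift k to ℕ using ne_top_of_le_ne_top (ENat.natCast_ne_top K) hkK
    exact Set.mem_biUnion (x := k) (by exact_mod_cast hkK) ⟨hLω, by simpa using hk⟩
  have hkR : (k : ℝ) ≤ K := by exact_mod_cast hkK
  have hX : P {ω | L t ω - jumpSum N A t ω ∈ Metric.ball (x - k • a) (ε / 2)} ≠ 0 := by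
    refine fun h0 => hk (measure_mono_null_ae ?_ h0)
    filter_upwards [hint] with ω hω h
    obtain ⟨h1, h2⟩ := h
    have h3 := norm_jumpSum_sub_le subset_rfl hω h2
    change _ ∈ Metric.ball _ _
    rw [mem_ball_iff_norm] at h1 ⊢
    have h4 : L t ω - jumpSum N A t ω - (x - k • a) =
        (L t ω - x) - (jumpSum N A t ω - k • a) := by abel
    rw [h4]
    have := norm_sub_le (L t ω - x) (jumpSum N A t ω - k • a)
    nlinarith
  -- The exchange of `k` for `k + 1`; the final error is below `ε / 2 + ε / 4`.
  have hfinal := hL.measure_sub_jumpSum_mem_and_count_pos hν hN (hball a η) hρ (hfar η hηρ) ht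
    (hball _ _) hX (k + 1) (Or.inr (hνa η hηpos))
  refine fun h0 => hfinal (measure_mono_null_ae ?_ h0)
  filter_upwards [hint] with ω hω h
  obtain ⟨h1, h2⟩ := h
  have h3 := norm_jumpSum_sub_le subset_rfl hω h2
  change _ ∈ Metric.ball _ _
  rw [mem_ball_iff_norm] at h1 ⊢
  have h4 : L t ω - (x + a) = (L t ω - jumpSum N A t ω - (x - k • a)) +
      (jumpSum N A t ω - (k + 1) • a) := by rw [succ_nsmul]; abel
  rw [h4]
  have := norm_add_le (L t ω - jumpSum N A t ω - (x - k • a)) (jumpSum N A t ω - (k + 1) • a)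
  push_cast at h3
  nlinarith

theorem IsPureJumpLevyProcess.support_add_sum (hν : IsLevyMeasure ν)
    (hN : IsTimeHomogeneousPRM P N ν) (hL : IsPureJumpLevyProcess P N ν b L) {t : ℝ≥0} (ht : 0 < t)
    {ι : Type*} (s : Finset ι) {x : H} {a : ι → H} (ha : ∀ i, a i ≠ 0)
    (hx : ∀ δ : ℝ, 0 < δ → P {ω | L t ω ∈ Metric.ball x δ} ≠ 0)
    (hνa : ∀ i, ∀ η : ℝ, 0 < η → ν (Metric.ball (a i) η) ≠ 0) :
    ∀ ε : ℝ, 0 < ε → P {ω | L t ω ∈ Metric.ball (x + ∑ i ∈ s, a i) ε} ≠ 0 := by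
  classical
  induction s using Finset.induction_on with
  | empty => simpa using hx
  | insert i s his ih =>
    intro ε hε
    rw [Finset.sum_insert his, add_comm (a i), ← add_assoc]
    exact hL.support_add hν hN ht (ha i) ih (hνa i) hε

end Support

end LevySupport

theorem corollary2p3 {Ω H : Type*} [MeasurableSpace Ω]
    [NormedAddCommGroup H] [InnerProductSpace ℝ H] [CompleteSpace H]
    [TopologicalSpace.SeparableSpace H] [MeasurableSpace H] [BorelSpace H]
    (P : Measure Ω) [IsProbabilityMeasure P]
    (ν : Measure H) [SigmaFinite ν] (hν : LevySupport.IsLevyMeasure ν)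
    (N : Ω → Measure (H × ℝ)) (hN : LevySupport.IsTimeHomogeneousPRM P N ν)
    (b : H) (L : ℝ≥0 → Ω → H) (hL : LevySupport.IsPureJumpLevyProcess P N ν b L)
    (hjump : LevySupport.JumpsReachEveryBall ν) :
    ∀ s : ℝ≥0, 0 < s → ∀ ε : ℝ, 0 < ε → ∀ h : H,
      0 < P {ω | L s ω ∈ Metric.ball h ε} := by
  intro s hs ε hε h
  have : SecondCountableTopology H := UniformSpace.secondCountable_of_separable H
  have hLs := hL.aemeasurable hν hN s
  have hmap : ∀ (y : H) (δ : ℝ), P.map (L s) (Metric.ball y δ) = P {ω | L s ω ∈ Metric.ball y δ} :=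
    fun y δ => Measure.map_apply_of_aemeasurable hLs Metric.isOpen_ball.measurableSet
  obtain ⟨x₀, hx₀⟩ := hL.exists_measure_ball_ne_zero hν hN hs one_pos
  rw [← hmap] at hx₀
  obtain ⟨x, -, hx⟩ := LevySupport.exists_mem_ball_forall_measure_ball_ne_zero hx₀
  simp_rw [hmap] at hx
  -- The target is shifted by `x`, so it does not matter which support point was found.
  obtain ⟨n, η, a, -, -, -, h0, hpos, hsub⟩ := hjump (h - x) (ε / 2) (by positivity)
  -- The centres `a i` need not lie in the support of `ν`, so nearby support points replace them;
  -- these are nonzero because the balls avoid the origin.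
  choose c hc hcν using fun i =>
    LevySupport.exists_mem_ball_forall_measure_ball_ne_zero (hpos i).ne'
  have hc0 : ∀ i, c i ≠ 0 := fun i hi =>
    h0 i (hi ▸ Metric.ball_subset_closedBall (hc i))
  have hsum := hL.support_add_sum hν hN hs Finset.univ hc0 hx hcν (ε / 2) (by positivity)
  have hnear : ∑ i, c i ∈ Metric.ball (h - x) (ε / 2) := hsub ⟨c, hc, rfl⟩
  refine pos_iff_ne_zero.2 fun hzero => hsum (measure_mono_null (fun ω hω => ?_) hzero)
  refine Metric.ball_subset_ball' ?_ hω
  rw [mem_ball_iff_norm] at hnear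
  rw [dist_eq_norm, show x + ∑ i, c i - h = ∑ i, c i - (h - x) by abel]
  linarith
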